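/- **Conventions.** A Gr-category is a monoidal category in which every morphism is an isomorphism and every object is invertible for $\otimes$; its associativity constraint is written $\mathbf a_{X,Y,Z}:(X\otimes Y)\otimes Z\to X\otimes(Y\otimes Z)$. A braided Gr-category $\mathbb B$ carries in addition a braiding $\mathbf c_{X,Y}:X\otimes Y\to Y\otimes X$ satisfying the two hexagon axioms. Then $\pi_0\mathbb B$ (isomorphism classes of objects, with $\otimes$) and $\pi_1\mathbb B=\mathrm{Aut}(I)$ are abelian groups, written additively, and $\pi_0\mathbb B$ acts trivially on $\pi_1\mathbb B$. For $u\in\pi_1\mathbb B$ let $\gamma_X(u)=\mathbf l_X\circ(u\otimes \mathrm{id}_X)\circ \mathbf l_X^{-1}\in \mathrm{Aut}(X)$. A braided Gr-functor $F:\mathbb B\to\mathbb B'$ (a strong monoidal functor compatible with the braidings) induces $F_0:\pi_0\mathbb B\to\pi_0\mathbb B'$, $[X]\mapsto[FX]$, and $F_1:\pi_1\mathbb B\to\pi_1\mathbb B'$, $u\mapsto F_*^{-1}F(u)F_*$, where $F_*:I'\to FI$ is the unit isomorphism. **Abelian cohomology.** For abelian groups $M,N$, an abelian 3-cocycle is a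 pair $(h,\eta)$ of functions $h:M^3\to N$, $\eta:M^2\to N$, with $h(x,y,z)=0$ whenever one argument is $0$, such that $$h(y,z,t)-h(x+y,z,t)+h(x,y+z,t)-h(x,y,z+t)+h(x,y,z)=0,$$ $$h(x,y,z)-h(y,x,z)+h(y,z,x)+\eta(x,y+z)-\eta(x,y)-\eta(x,z)=0,$$ $$h(x,y,z)-h(x,z,y)+h(z,x,y)-\eta(x+y,z)+\eta(y,z)+\eta(x,z)=0.$$ The coboundary of a function $g:M^2\to N$ with $g(x,0)=g(0,y)=0$ is $\partial_{ab}(g)=(h,\eta)$, where $h(x,y,z)=g(y,z)-g(x+y,z)+g(x,y+z)-g(x,y)$ and $\eta(x,y)=g(y,x)-g(x,y)$. The group $H^3_{ab}(M,N)$ is the group of abelian 3-cocycles modulo coboundaries; homomorphisms $\varphi:M'\to M$ and $f:N\to N'$ induce $\varphi^*:H^3_{ab}(M,N)\to H^3_{ab}(M',N)$ and $f_*:H^3_{ab}(M,N)\to H^3_{ab}(M,N')$. **The class of $\mathbb B$.** A stick of $\mathbb B$ consists of a representative $X_s$ of each class $s\in\pi_0\mathbb B$, with $X_0=I$, and isomorphisms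 $i_{s,t}:X_s\otimes X_t\to X_{s+t}$ with $i_{0,s}=\mathbf l_{X_s}$ and $i_{s,0}=\mathbf r_{X_s}$. Its reduction is the pair of functions $h:(\pi_0\mathbb B)^3\to\pi_1\mathbb B$, $\eta:(\pi_0\mathbb B)^2\to\pi_1\mathbb B$ with $$\gamma_{X_{s+t+r}}(h(s,t,r))\circ i_{s+t,r}\circ(i_{s,t}\otimes \mathrm{id})=i_{s,t+r}\circ(\mathrm{id}\otimes i_{t,r})\circ\mathbf a_{X_s,X_t,X_r},\qquad \gamma_{X_{s+t}}(\eta(s,t))\circ i_{s,t}=i_{t,s}\circ\mathbf c_{X_s,X_t}.$$ **Theorem 4.4.** Fix abelian groups $M$ and $N$. (a) Every braided Gr-category $\mathbb B$ has a stick, and for every stick there is exactly one pair $(h,\eta)$ as above; this pair is an abelian 3-cocycle for $\pi_0\mathbb B$ with coefficients in $\pi_1\mathbb B$. Write $[(h,\eta)_{\mathbb B}]\in H^3_{ab}(\pi_0\mathbb B,\pi_1\mathbb B)$ for its class. (b) Consider braided Gr-categories $\mathbb B$ with a pre-stick of type $(M,N)$, that is, with a pair of group isomorphisms $p:M\to\pi_0\mathbb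 B$, $q:N\to\pi_1\mathbb B$. A morphism $(\mathbb B,p,q)\to(\mathbb B',p',q')$ is a braided Gr-functor $F:\mathbb B\to\mathbb B'$ with $F_0p=p'$ and $F_1q=q'$. The existence of a morphism is an equivalence relation on these objects; let $\mathcal{BCG}[M,N]$ be the collection of its equivalence classes. (c) There is a bijection $$\Gamma:\mathcal{BCG}[M,N]\to H^3_{ab}(M,N),\qquad [(\mathbb B,p,q)]\mapsto q_*^{-1}p^*[(h,\eta)_{\mathbb B}],$$ where the formula holds for the class $[(h,\eta)_{\mathbb B}]$ obtained from any stick of $\mathbb B$. -/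

import Mathlib

open CategoryTheory MonoidalCategory

universe v u w₁ w₂ w₃

/-! ### Abelian cohomology in degree three -/

namespace AbCoh

section Cochains

variable (M : Type w₁) [AddCommGroup M] (N : Type w₂) [AddCommGroup N]

/-- Pairs `(h, η)` of functions `h : M³ → N` and `η : M² → N`, under pointwise addition. -/
abbrev Cochain : Type (max w₁ w₂) := (M → M → M → N) × (M → M → N)

/-- The group `Z³_ab(M, N)` of abelian 3-cocycles: `h` is a normalized 3-cocycle (for the trivial
action of `M` on `N`), and the two hexagon relations hold between `h` and `η`. -/
def Z3ab : AddSubgroup (Cochain M N) where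
  carrier := {c |
    (∀ y z, c.1 0 y z = 0) ∧ (∀ x z, c.1 x 0 z = 0) ∧ (∀ x y, c.1 x y 0 = 0) ∧
    (∀ x y z t, c.1 y z t - c.1 (x + y) z t + c.1 x (y + z) t - c.1 x y (z + t)
      + c.1 x y z = 0) ∧
    (∀ x y z, c.1 x y z - c.1 y x z + c.1 y z x + c.2 x (y + z) - c.2 x y - c.2 x z = 0) ∧
    (∀ x y z, c.1 x y z - c.1 x z y + c.1 z x y - c.2 (x + y) z + c.2 y z + c.2 x z = 0)}
  zero_mem' := by simp
  add_mem' := by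
    rintro a b ⟨a1, a2, a3, a4, a5, a6⟩ ⟨b1, b2, b3, b4, b5, b6⟩
    refine ⟨by simp [a1, b1], by simp [a2, b2], by simp [a3, b3], fun x y z t => ?_,
      fun x y z => ?_, fun x y z => ?_⟩
    · refine Eq.trans ?_ ((congrArg₂ (· + ·) (a4 x y z t) (b4 x y z t)).trans (add_zero 0))
      simp only [Prod.fst_add, Pi.add_apply]; abel
    · refine Eq.trans ?_ ((congrArg₂ (· + ·) (a5 x y z) (b5 x y z)).trans (add_zero 0))
      simp only [Prod.fst_add, Prod.snd_add, Pi.add_apply]; abel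
    · refine Eq.trans ?_ ((congrArg₂ (· + ·) (a6 x y z) (b6 x y z)).trans (add_zero 0))
      simp only [Prod.fst_add, Prod.snd_add, Pi.add_apply]; abel
  neg_mem' := by
    rintro a ⟨a1, a2, a3, a4, a5, a6⟩
    refine ⟨by simp [a1], by simp [a2], by simp [a3], fun x y z t => ?_,
      fun x y z => ?_, fun x y z => ?_⟩
    · refine Eq.trans ?_ ((congrArg Neg.neg (a4 x y z t)).trans neg_zero)
      simp only [Prod.fst_neg, Pi.neg_apply]; abel
    · refine Eq.trans ?_ ((congrArg Neg.neg (a5 x y z)).trans neg_zero)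
      simp only [Prod.fst_neg, Prod.snd_neg, Pi.neg_apply]; abel
    · refine Eq.trans ?_ ((congrArg Neg.neg (a6 x y z)).trans neg_zero)
      simp only [Prod.fst_neg, Prod.snd_neg, Pi.neg_apply]; abel

/-- Normalized functions `g : M² → N`, that is `g(x, 0) = g(0, y) = 0`. -/
def C2 : AddSubgroup (M → M → N) where
  carrier := {g | (∀ x, g x 0 = 0) ∧ ∀ y, g 0 y = 0}
  zero_mem' := by simp
  add_mem' := by
    rintro a b ⟨a1, a2⟩ ⟨b1, b2⟩
    exact ⟨by simp [a1, b1], by simp [a2, b2]⟩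
  neg_mem' := by
    rintro a ⟨a1, a2⟩
    exact ⟨by simp [a1], by simp [a2]⟩

/-- The coboundary `∂_ab(g) = (h, η)` with
`h(x, y, z) = g(y, z) - g(x + y, z) + g(x, y + z) - g(x, y)` and `η(x, y) = g(y, x) - g(x, y)`. -/
def dab : (M → M → N) →+ Cochain M N where
  toFun g := (fun x y z => g y z - g (x + y) z + g x (y + z) - g x y,
    fun x y => g y x - g x y)
  map_zero' := by
    ext <;> simp
  map_add' a b := by
    ext
    · simp only [Prod.fst_add, Pi.add_apply]; abel
    · simp only [Prod.snd_add, Pi.add_apply]; abel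

/-- The group `B³_ab(M, N)` of coboundaries of normalized functions. -/
def B3ab : AddSubgroup (Cochain M N) := (C2 M N).map (dab M N)

theorem B3ab_le_Z3ab : B3ab M N ≤ Z3ab M N := by
  rintro _ ⟨g, ⟨g1, g2⟩, rfl⟩
  refine ⟨fun y z => ?_, fun x z => ?_, fun x y => ?_, fun x y z t => ?_, fun x y z => ?_,
    fun x y z => ?_⟩
  · simp [dab, g2]
  · simp [dab, g1, g2]
  · simp [dab, g1]
  · simp only [dab, AddMonoidHom.coe_mk, ZeroHom.coe_mk, add_assoc]; abel
  · simp only [dab, AddMonoidHom.coe_mk, ZeroHom.coe_mk, add_comm z x, add_comm y x]; abel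
  · simp only [dab, AddMonoidHom.coe_mk, ZeroHom.coe_mk, add_comm z x, add_comm z y]; abel

/-- The abelian cohomology group `H³_ab(M, N) = Z³_ab(M, N) / B³_ab(M, N)`. -/
abbrev H3ab : Type (max w₁ w₂) := Z3ab M N ⧸ (B3ab M N).addSubgroupOf (Z3ab M N)

variable {M N}

/-- The class of an abelian 3-cocycle. -/
def H3ab.mk (c : Z3ab M N) : H3ab M N := QuotientAddGroup.mk c

end Cochains

section Functoriality

variable {M : Type w₁} [AddCommGroup M] {N : Type w₂} [AddCommGroup N]

/-- `φ^*` on cocycles: `(φ^*(h, η))(x, y, z) = (h(φx, φy, φz), η(φx, φy))`. -/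
def Z3ab.pull {M' : Type w₃} [AddCommGroup M'] (φ : M' →+ M) : Z3ab M N →+ Z3ab M' N where
  toFun c := ⟨(fun x y z => c.1.1 (φ x) (φ y) (φ z), fun x y => c.1.2 (φ x) (φ y)), by
    obtain ⟨a1, a2, a3, a4, a5, a6⟩ := c.2
    exact ⟨fun y z => by simp [a1], fun y z => by simp [a2], fun y z => by simp [a3],
      fun x y z t => by simpa using a4 (φ x) (φ y) (φ z) (φ t),
      fun x y z => by simpa using a5 (φ x) (φ y) (φ z),
      fun x y z => by simpa using a6 (φ x) (φ y) (φ z)⟩⟩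
  map_zero' := rfl
  map_add' _ _ := rfl

/-- `f_*` on cocycles: `f_*(h, η) = (f ∘ h, f ∘ η)`. -/
def Z3ab.push {N' : Type w₃} [AddCommGroup N'] (f : N →+ N') : Z3ab M N →+ Z3ab M N' where
  toFun c := ⟨(fun x y z => f (c.1.1 x y z), fun x y => f (c.1.2 x y)), by
    obtain ⟨a1, a2, a3, a4, a5, a6⟩ := c.2
    exact ⟨fun y z => by simp [a1], fun y z => by simp [a2], fun y z => by simp [a3],
      fun x y z t => by simpa using congrArg f (a4 x y z t),
      fun x y z => by simpa using congrArg f (a5 x y z),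
      fun x y z => by simpa using congrArg f (a6 x y z)⟩⟩
  map_zero' := by ext <;> simp
  map_add' a b := by ext <;> simp

/-- The homomorphism `φ^* : H³_ab(M, N) → H³_ab(M', N)` induced by `φ : M' → M`. -/
def H3ab.pull {M' : Type w₃} [AddCommGroup M'] (φ : M' →+ M) : H3ab M N →+ H3ab M' N :=
  QuotientAddGroup.map _ _ (Z3ab.pull φ) (by
    rintro c ⟨g, ⟨g1, g2⟩, hg⟩
    refine ⟨fun x y => g (φ x) (φ y), ⟨fun x => by simp [g1], fun y => by simp [g2]⟩, ?_⟩
    have hg' : dab M N g = c.1 := hg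
    change _ = (Z3ab.pull φ c).1
    simp [Z3ab.pull, ← hg', dab])

/-- The homomorphism `f_* : H³_ab(M, N) → H³_ab(M, N')` induced by `f : N → N'`. -/
def H3ab.push {N' : Type w₃} [AddCommGroup N'] (f : N →+ N') : H3ab M N →+ H3ab M N' :=
  QuotientAddGroup.map _ _ (Z3ab.push f) (by
    rintro c ⟨g, ⟨g1, g2⟩, hg⟩
    refine ⟨fun x y => f (g x y), ⟨fun x => by simp [g1], fun y => by simp [g2]⟩, ?_⟩
    have hg' : dab M N g = c.1 := hg
    change _ = (Z3ab.push f c).1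
    simp [Z3ab.push, ← hg', dab])

end Functoriality

end AbCoh

/-! ### Gr-categories and their invariants -/

namespace GrCat

/-- A Gr-category: a monoidal category in which every morphism is an isomorphism and every object
is invertible. A braided Gr-category is one that carries a `BraidedCategory` structure. -/
class IsGrCategory (C : Type u) [Category.{v} C] [MonoidalCategory C] : Prop
    extends IsGroupoid C where
  exists_inverse : ∀ X : C, ∃ Y : C, Nonempty (X ⊗ Y ≅ 𝟙_ C) ∧ Nonempty (Y ⊗ X ≅ 𝟙_ C)

section Invariants

variable (C : Type u) [Category.{v} C]

/-- `π₀`: the set of isomorphism classes of objects. -/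
def Pi0 : Type u := Quotient (isIsomorphicSetoid C)

variable {C} in
/-- The isomorphism class of an object. -/
def Pi0.cls (X : C) : Pi0 C := Quotient.mk (isIsomorphicSetoid C) X

variable [MonoidalCategory C]

/-- `π₁`: the automorphisms of the unit object. -/
def Pi1 : Type v := Aut (𝟙_ C)

variable {C} in
/-- The underlying automorphism of the unit object. -/
def Pi1.toIso (a : Pi1 C) : 𝟙_ C ≅ 𝟙_ C := a

theorem unit_comp_comm {C : Type u} [Category.{v} C] [MonoidalCategory C]
    (f g : 𝟙_ C ⟶ 𝟙_ C) : f ≫ g = g ≫ f := by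
  have h := whisker_exchange f g
  rw [id_whiskerLeft, whiskerRight_id] at h
  simpa [← unitors_equal, ← unitors_inv_equal] using h.symm

/-- `π₁` is an abelian group, written additively, under composition of automorphisms. -/
instance : AddCommGroup (Pi1 C) :=
  { (inferInstanceAs (AddGroup (Additive (Aut (𝟙_ C)))) : AddGroup (Pi1 C)) with
    add_comm := fun a b => Iso.ext (unit_comp_comm (Iso.hom b) (Iso.hom a)) }

/-- `[X] + [Y] = [X ⊗ Y]`. -/
instance : Add (Pi0 C) where
  add := Quotient.map₂ (· ⊗ ·) (fun _ _ ⟨e⟩ _ _ ⟨e'⟩ => ⟨e ⊗ᵢ e'⟩)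

/-- The class of the unit object is the neutral element. -/
instance : Zero (Pi0 C) where
  zero := Pi0.cls (𝟙_ C)

variable [BraidedCategory C] [IsGrCategory C]

/-- `-[X] = [Y]` for an inverse `Y` of `X`. -/
noncomputable instance : Neg (Pi0 C) where
  neg := Quotient.map (fun X => (IsGrCategory.exists_inverse X).choose) (by
    rintro X X' ⟨e⟩
    obtain ⟨-, ⟨b⟩⟩ := (IsGrCategory.exists_inverse X).choose_spec
    obtain ⟨⟨a'⟩, -⟩ := (IsGrCategory.exists_inverse X').choose_spec
    generalize (IsGrCategory.exists_inverse X).choose = Y at *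
    generalize (IsGrCategory.exists_inverse X').choose = Y' at *
    exact ⟨(ρ_ Y).symm ≪≫ whiskerLeftIso Y a'.symm ≪≫ (α_ Y X' Y').symm ≪≫
      whiskerRightIso (whiskerLeftIso Y e.symm ≪≫ b) Y' ≪≫ λ_ Y'⟩)

/-- `π₀` of a braided Gr-category is an abelian group, written additively, under the operation
induced by the tensor product. -/
noncomputable instance : AddCommGroup (Pi0 C) where
  add_assoc := by
    rintro ⟨X⟩ ⟨Y⟩ ⟨Z⟩
    exact Quotient.sound ⟨α_ X Y Z⟩
  zero_add := by
    rintro ⟨X⟩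
    exact Quotient.sound ⟨λ_ X⟩
  add_zero := by
    rintro ⟨X⟩
    exact Quotient.sound ⟨ρ_ X⟩
  neg_add_cancel := by
    rintro ⟨X⟩
    obtain ⟨-, h⟩ := (IsGrCategory.exists_inverse X).choose_spec
    exact Quotient.sound h
  add_comm := by
    rintro ⟨X⟩ ⟨Y⟩
    exact Quotient.sound ⟨β_ X Y⟩
  nsmul := nsmulRec
  zsmul := zsmulRec

end Invariants

section Action

variable {C : Type u} [Category.{v} C] [MonoidalCategory C]

/-- `γ_X(u) : X ⟶ X`, determined by `γ_X(u) ∘ l_X = l_X ∘ (u ⊗ id)`. -/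
def gamma (X : C) (a : Pi1 C) : X ⟶ X := (λ_ X).inv ≫ a.toIso.hom ▷ X ≫ (λ_ X).hom

/-- `δ_X(u) : X ⟶ X`, determined by `δ_X(u) ∘ r_X = r_X ∘ (id ⊗ u)`. -/
def delta (X : C) (a : Pi1 C) : X ⟶ X := (ρ_ X).inv ≫ X ◁ a.toIso.hom ≫ (ρ_ X).hom

/-- In the braided case the action `s • u = γ_X⁻¹(δ_X(u))`, `X ∈ s`, of `π₀` on `π₁` is trivial. -/
theorem gamma_eq_delta [BraidedCategory C] (X : C) (a : Pi1 C) : gamma X a = delta X a := by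
  have h := BraidedCategory.braiding_naturality_right X a.toIso.hom
  have h1 := braiding_leftUnitor X
  simp only [gamma, delta]
  rw [Iso.eq_inv_comp, ← h1, reassoc_of% h]
  simp

end Action

section FunctorMaps

variable {C : Type u} [Category.{v} C] [MonoidalCategory C]
  {D : Type u} [Category.{v} D] [MonoidalCategory D]

/-- `F₀ : π₀C → π₀D`, `[X] ↦ [FX]`. -/
def mapPi0 (F : C ⥤ D) : Pi0 C → Pi0 D :=
  Quotient.map F.obj (fun _ _ ⟨e⟩ => ⟨F.mapIso e⟩)

/-- `F₁ : π₁C → π₁D`, `u ↦ F_*⁻¹ ∘ F(u) ∘ F_*` with `F_* : I' ≅ FI` the unit isomorphism of `F`. -/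
def mapPi1 (F : C ⥤ D) [F.Monoidal] (a : Pi1 C) : Pi1 D :=
  (Functor.Monoidal.εIso F ≪≫ F.mapIso a.toIso ≪≫ (Functor.Monoidal.εIso F).symm : 𝟙_ D ≅ 𝟙_ D)

/-- `F₁(u)` is also characterized by `γ_{FI}(F₁(u)) = F(u)`. -/
theorem gamma_mapPi1 (F : C ⥤ D) [F.Monoidal] (a : Pi1 C) :
    gamma (F.obj (𝟙_ C)) (mapPi1 F a) = F.map a.toIso.hom := by
  have key : ∀ {X Y : D} (e : X ⟶ Y) (b : Pi1 D), gamma X b ≫ e = e ≫ gamma Y b := by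
    intro X Y e b
    simp only [gamma, Category.assoc, ← leftUnitor_naturality]
    rw [← whisker_exchange_assoc, ← leftUnitor_inv_naturality_assoc]
  have unit : ∀ b : Pi1 D, gamma (𝟙_ D) b = b.toIso.hom := by
    intro b
    simp only [gamma, unitors_inv_equal, whiskerRight_id]
    rw [unitors_equal]
    simp
  have h := key (Functor.Monoidal.εIso F).hom (mapPi1 F a)
  rw [unit, ← Iso.inv_comp_eq] at h
  rw [← h]
  have h2 : (mapPi1 F a).toIso =
      Functor.Monoidal.εIso F ≪≫ F.mapIso a.toIso ≪≫ (Functor.Monoidal.εIso F).symm := rfl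
  rw [h2]
  simp

end FunctorMaps

section Reduction

variable (C : Type u) [Category.{v} C] [MonoidalCategory C] [BraidedCategory C] [IsGrCategory C]

/-- A stick of a braided Gr-category: a representative `X_s` of every class `s ∈ π₀`, with
`X_0 = I`, and isomorphisms `i_{s,t} : X_s ⊗ X_t ≅ X_{s+t}` that are the unit constraints when
`s = 0` or `t = 0`. The target is written `X_r` with a proof of `s + t = r`. -/
structure Stick where
  /-- the representatives -/
  rep : Pi0 C → C
  cls_rep : ∀ s, Pi0.cls (rep s) = s
  rep_zero : rep 0 = 𝟙_ C
  /-- the isomorphisms `X_s ⊗ X_t ≅ X_{s+t}` -/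
  iso : ∀ s t r : Pi0 C, s + t = r → (rep s ⊗ rep t ≅ rep r)
  iso_zero_left : ∀ s, (iso 0 s s (zero_add s)).hom = eqToHom rep_zero ▷ rep s ≫ (λ_ (rep s)).hom
  iso_zero_right : ∀ s, (iso s 0 s (add_zero s)).hom = rep s ◁ eqToHom rep_zero ≫ (ρ_ (rep s)).hom

variable {C}

/-- The pair `(h, η)` consists of the associativity and the braiding constraint of the reduction
along the stick `σ`: the constraints of the category with objects `s ∈ π₀` and automorphism groups
`π₁` for which `s ↦ X_s`, `(s, u) ↦ γ_{X_s}(u)`, together with the isomorphisms `i_{s,t}`, is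
compatible with associativity and braiding. -/
def Stick.IsReduction (σ : Stick C) (c : AbCoh.Cochain (Pi0 C) (Pi1 C)) : Prop :=
  (∀ s t r : Pi0 C,
    (σ.iso s t (s + t) rfl).hom ▷ σ.rep r ≫ (σ.iso (s + t) r (s + t + r) rfl).hom ≫
        gamma (σ.rep (s + t + r)) (c.1 s t r) =
      (α_ (σ.rep s) (σ.rep t) (σ.rep r)).hom ≫ σ.rep s ◁ (σ.iso t r (t + r) rfl).hom ≫
        (σ.iso s (t + r) (s + t + r) (add_assoc s t r).symm).hom) ∧
  (∀ s t : Pi0 C,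
    (σ.iso s t (s + t) rfl).hom ≫ gamma (σ.rep (s + t)) (c.2 s t) =
      (β_ (σ.rep s) (σ.rep t)).hom ≫ (σ.iso t s (s + t) (add_comm t s)).hom)

end Reduction

/-! ### Braided Gr-categories with a pre-stick -/

/-- A braided Gr-category `𝔹` together with a pre-stick `(p, q)` of type `(M, N)`: isomorphisms
`p : M ≅ π₀𝔹` and `q : N ≅ π₁𝔹`. Here `N` is the trivial `M`-module; compatibility of `(p, q)`
with the actions is automatic, because `π₀𝔹` acts trivially on `π₁𝔹` (`gamma_eq_delta`). -/
structure PreSticked (M : Type u) [AddCommGroup M] (N : Type v) [AddCommGroup N] where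
  /-- the underlying type of objects of `𝔹` -/
  C : Type u
  [cat : Category.{v} C]
  [mon : MonoidalCategory C]
  [braided : BraidedCategory C]
  [gr : IsGrCategory C]
  /-- the isomorphism with `π₀` -/
  p : M ≃+ Pi0 C
  /-- the isomorphism with `π₁` -/
  q : N ≃+ Pi1 C

attribute [instance] PreSticked.cat PreSticked.mon PreSticked.braided PreSticked.gr

/-- There is a morphism `(𝔹, p, q) → (𝔹', p', q')`: a braided Gr-functor `F : 𝔹 → 𝔹'` with
`F₀ ∘ p = p'` and `F₁ ∘ q = q'`. Two such objects are equivalent when this holds. -/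
def PreSticked.Rel {M : Type u} [AddCommGroup M] {N : Type v} [AddCommGroup N]
    (A B : PreSticked M N) : Prop :=
  ∃ (F : A.C ⥤ B.C) (_ : F.Braided),
    (∀ m, mapPi0 F (A.p m) = B.p m) ∧ ∀ n, mapPi1 F (A.q n) = B.q n

end GrCat

/-! Because every object is invertible, `u ↦ γ_X(u)` identifies `π₁` with `Aut(X)` for every `X`
(`gamma_injective`, `gamma_surjective`), compatibly with morphisms, tensor products and monoidal
functors (`gamma_naturality`, `whiskerLeft_gamma`, `map_gamma`). Along a stick, associativity and
braiding therefore become `π₁`-valued functions `(h, η)`.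

In the other direction, a cocycle defines a braided Gr-category `Red` with objects `M`, automorphism
groups `N` and constraints `h`, `η`: the cocycle relations are exactly its coherence axioms.

The link is a `Realization`, the data of a structure-preserving functor out of `Red`. A stick
realizes its own reduction. Coherence in the target then descends along a faithful functor and makes
the reduction a cocycle (`Realization.mem_Z3ab`), and the functor itself relates the reduced
category to the given one (`rel_of_isReduction`). A function `g` with `∂_ab(g)` equal to the
difference of two cocycles realizes one in the reduced category of the other (`rel_of_mk_eq`);
conversely, the tensorator of a functor between reduced categories yields such a `g`
(`mk_eq_of_functor`). Since morphisms of pre-sticked categories are equivalences (`Rel.symm`),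
classes of categories and cohomology classes correspond. -/

namespace GrCat

/-! ### The identification of `π₁` with automorphism groups -/

section Gamma

variable {C : Type u} [Category.{v} C] [MonoidalCategory C]

theorem gamma_naturality {X Y : C} (f : X ⟶ Y) (a : Pi1 C) :
    gamma X a ≫ f = f ≫ gamma Y a := by
  simp only [gamma, Category.assoc, ← leftUnitor_naturality]
  rw [← whisker_exchange_assoc, ← leftUnitor_inv_naturality_assoc]

theorem gamma_unit (a : Pi1 C) : gamma (𝟙_ C) a = a.toIso.hom := by
  simp only [gamma, unitors_inv_equal, whiskerRight_id]
  rw [unitors_equal]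
  simp

theorem toIso_add (a b : Pi1 C) : (a + b).toIso.hom = b.toIso.hom ≫ a.toIso.hom := rfl

theorem toIso_zero : (0 : Pi1 C).toIso.hom = 𝟙 _ := rfl

@[simp]
theorem gamma_zero (X : C) : gamma X (0 : Pi1 C) = 𝟙 X := by
  simp [gamma, toIso_zero]

theorem gamma_add (X : C) (a b : Pi1 C) : gamma X (a + b) = gamma X a ≫ gamma X b := by
  rw [add_comm]
  simp [gamma, toIso_add]

theorem gamma_whiskerRight (X Y : C) (a : Pi1 C) : gamma X a ▷ Y = gamma (X ⊗ Y) a := by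
  simp [gamma]

/-- Left whiskering is visibly compatible with `δ`, right whiskering with `γ`; the braiding
identifies the two. -/
theorem whiskerLeft_gamma [BraidedCategory C] (X Y : C) (a : Pi1 C) :
    X ◁ gamma Y a = gamma (X ⊗ Y) a := by
  rw [gamma_eq_delta, gamma_eq_delta]
  simp [delta]

/-- Tensoring further with the inverse `Z` reduces to whiskering with the unit, by the exchange law
along `e`. -/
theorem whiskerRight_injective_of_iso {Y Z : C} (e : Y ⊗ Z ≅ 𝟙_ C) {W W' : C}
    {f g : W ⟶ W'} (h : f ▷ Y = g ▷ Y) : f = g := by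
  have h1 : f ▷ (Y ⊗ Z) = g ▷ (Y ⊗ Z) := by
    rw [whiskerRight_tensor, whiskerRight_tensor, h]
  have h2 : f ▷ (𝟙_ C) = g ▷ (𝟙_ C) := by
    rw [← cancel_epi (W ◁ e.hom), whisker_exchange, whisker_exchange, h1]
  simpa using h2

theorem gamma_injective [IsGrCategory C] (X : C) : Function.Injective (gamma X) := by
  intro a b h
  obtain ⟨Y, ⟨e⟩, -⟩ := IsGrCategory.exists_inverse X
  have h1 : a.toIso.hom ▷ X = b.toIso.hom ▷ X := by
    simpa [gamma] using h
  exact Iso.ext (whiskerRight_injective_of_iso e h1)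

theorem gamma_surjective [IsGrCategory C] (X : C) : Function.Surjective (gamma X) := by
  intro f
  obtain ⟨Y, ⟨e⟩, ⟨e'⟩⟩ := IsGrCategory.exists_inverse X
  -- Tensoring `f` with an inverse of `X` moves it to an automorphism of the unit; `γ` of that
  -- automorphism agrees with `f` after whiskering with `Y`.
  let a : Pi1 C := (asIso (e.inv ≫ f ▷ Y ≫ e.hom) : 𝟙_ C ≅ 𝟙_ C)
  refine ⟨a, whiskerRight_injective_of_iso e' ?_⟩
  have h : gamma (𝟙_ C) a = e.inv ≫ f ▷ Y ≫ e.hom := gamma_unit a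
  rw [gamma_whiskerRight, ← cancel_mono e.hom, gamma_naturality, h]
  simp

end Gamma

/-! ### Monoidal functors and their maps on `π₀` and `π₁` -/

section Functors

variable {C : Type u} [Category.{v} C] [MonoidalCategory C]
  {D : Type u} [Category.{v} D] [MonoidalCategory D]

/-- The case of the unit object is `gamma_mapPi1`; it spreads to `X` through the left unitor and the
tensorator, past which `γ` slides by naturality. -/
theorem map_gamma (F : C ⥤ D) [F.Monoidal] (X : C) (a : Pi1 C) :
    F.map (gamma X a) = gamma (F.obj X) (mapPi1 F a) := by
  have h : F.map (a.toIso.hom ▷ X) = gamma (F.obj (𝟙_ C ⊗ X)) (mapPi1 F a) := by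
    rw [Functor.Monoidal.map_whiskerRight, ← gamma_mapPi1, gamma_whiskerRight,
      gamma_naturality]
    simp
  rw [gamma, F.map_comp, F.map_comp, h, gamma_naturality, ← F.map_comp_assoc]
  simp

theorem mapPi1_eq_of_map_gamma [IsGrCategory D] (F : C ⥤ D) [F.Monoidal] (X : C) {a : Pi1 C}
    {b : Pi1 D} (h : F.map (gamma X a) = gamma (F.obj X) b) : mapPi1 F a = b :=
  gamma_injective _ ((map_gamma F X a).symm.trans h)

/-- Injectivity on `π₀` supplies some isomorphism `X ≅ Y`; its image differs from `f` by an
automorphism, which is some `γ` and hence lifts. -/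
theorem full_of_mapPi1_surjective [IsGrCategory C] [IsGrCategory D] (F : C ⥤ D) [F.Monoidal]
    (h0 : Function.Injective (mapPi0 F)) (h1 : Function.Surjective (mapPi1 F)) : F.Full where
  map_surjective {X Y} f := by
    obtain ⟨e⟩ : Nonempty (X ≅ Y) := Quotient.exact
      (h0 (a₁ := Pi0.cls X) (a₂ := Pi0.cls Y) (Quotient.sound ⟨asIso f⟩))
    obtain ⟨b, hb⟩ := gamma_surjective (F.obj X) (f ≫ F.map e.inv)
    obtain ⟨a, rfl⟩ := h1 b
    refine ⟨gamma X a ≫ e.hom, ?_⟩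
    rw [F.map_comp, map_gamma, hb]
    simp [← F.map_comp]

theorem faithful_of_mapPi1_injective [IsGrCategory C] [IsGrCategory D] (F : C ⥤ D) [F.Monoidal]
    (h1 : Function.Injective (mapPi1 F)) : F.Faithful where
  map_injective {X Y} f g h := by
    obtain ⟨a, ha⟩ := gamma_surjective X (f ≫ inv g)
    have : a = 0 := h1 (by
      apply gamma_injective (F.obj X)
      rw [← map_gamma, ← map_gamma, ha, gamma_zero]
      simp [h])
    rw [this, gamma_zero] at ha
    simpa using congrArg (· ≫ g) ha.symm

end Functors

theorem essSurj_of_mapPi0_surjective {C D : Type u} [Category.{v} C] [Category.{v} D] (F : C ⥤ D)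
    (h0 : Function.Surjective (mapPi0 F)) : F.EssSurj where
  mem_essImage Y := by
    obtain ⟨⟨X⟩, hX⟩ := h0 (Pi0.cls Y)
    obtain ⟨e⟩ := Quotient.exact hX
    exact ⟨X, ⟨e⟩⟩


/-! ### Existence of a morphism is an equivalence relation -/

section Equivalence

variable {C : Type u} [Category.{v} C] [MonoidalCategory C] [BraidedCategory C]
  {D : Type u} [Category.{v} D] [MonoidalCategory D] [BraidedCategory D]

/-- The inverse of a braided equivalence is braided. -/
@[reducible]
noncomputable def inverseBraided (e : C ≌ D) [e.functor.Braided] : e.inverse.Braided :=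
  letI : e.inverse.Monoidal := e.inverseMonoidal
  haveI : e.toAdjunction.IsMonoidal := ⟨rfl, fun _ _ => rfl⟩
  { braided := fun X Y => e.functor.map_injective (by
      -- Composed with the counit, the tensorator of the inverse turns into that of `e.functor`, so
      -- naturality of the counit and of the braiding suffices.
      rw [← cancel_mono (e.toAdjunction.counit.app (Y ⊗ X)), Functor.map_comp, Functor.map_comp,
        Category.assoc, Category.assoc, e.toAdjunction.map_μ_comp_counit_app_tensor]
      have h := e.toAdjunction.counit.naturality (β_ X Y).hom
      dsimp at h ⊢
      rw [h]
      rw [reassoc_of% e.toAdjunction.map_μ_comp_counit_app_tensor X Y]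
      simp [Functor.map_braiding]) }

end Equivalence

namespace PreSticked

variable {M : Type u} [AddCommGroup M] {N : Type v} [AddCommGroup N]

theorem Rel.refl (A : PreSticked M N) : Rel A A :=
  ⟨𝟭 _, inferInstance, fun m => by
    generalize A.p m = s
    induction s using Quotient.inductionOn
    rfl, fun n => mapPi1_eq_of_map_gamma _ (𝟙_ _) rfl⟩

theorem Rel.trans {A B D : PreSticked M N} (h : Rel A B) (h' : Rel B D) : Rel A D := by
  obtain ⟨F, _, h0, h1⟩ := h
  obtain ⟨G, _, h0', h1'⟩ := h'
  refine ⟨F ⋙ G, inferInstance, fun m => ?_, fun n => mapPi1_eq_of_map_gamma _ (𝟙_ _) ?_⟩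
  · rw [← h0' m, ← h0 m]
    generalize A.p m = s
    induction s using Quotient.inductionOn
    rfl
  · rw [Functor.comp_map, map_gamma, map_gamma, h1, h1']
    rfl

/-- Both induced maps are bijective, being determined by the pre-sticks. Hence `F` is an
equivalence, and its inverse is a morphism. -/
theorem Rel.symm {A B : PreSticked M N} (h : Rel A B) : Rel B A := by
  obtain ⟨F, _, h0, h1⟩ := h
  have e0 : mapPi0 F = B.p ∘ A.p.symm := funext fun s => by
    simpa using h0 (A.p.symm s)
  have e1 : mapPi1 F = B.q ∘ A.q.symm := funext fun s => by
    simpa using h1 (A.q.symm s)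
  have b0 : Function.Bijective (mapPi0 F) :=
    e0 ▸ B.p.bijective.comp A.p.symm.bijective
  have b1 : Function.Bijective (mapPi1 F) :=
    e1 ▸ B.q.bijective.comp A.q.symm.bijective
  have := full_of_mapPi1_surjective F b0.1 b1.2
  have := faithful_of_mapPi1_injective F b1.1
  have := essSurj_of_mapPi0_surjective F b0.2
  have : F.IsEquivalence := { }
  obtain ⟨e, rfl⟩ : ∃ e : A.C ≌ B.C, e.functor = F := ⟨F.asEquivalence, rfl⟩
  let := inverseBraided e
  refine ⟨e.inverse, inferInstance, fun m => ?_, fun n =>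
    mapPi1_eq_of_map_gamma _ (e.functor.obj (𝟙_ _)) ?_⟩
  · rw [← h0 m]
    generalize A.p m = s
    induction s using Quotient.inductionOn with | h X => ?_
    exact Quotient.sound ⟨(e.unitIso.app X).symm⟩
  · rw [← h1 n, ← map_gamma]
    have h := e.unit.naturality (gamma (𝟙_ _) (A.q n))
    exact (cancel_epi (e.unit.app (𝟙_ A.C))).1 (h.symm.trans (gamma_naturality _ _))

theorem equivalence_rel : Equivalence (Rel (M := M) (N := N)) :=
  ⟨Rel.refl, Rel.symm, Rel.trans⟩

end PreSticked

end GrCat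

/-! ### The reduced braided Gr-category of a cocycle -/

namespace AbCoh

/-- The objects of the reduced category attached to a cochain `(h, η)`: the elements of `M`. -/
structure Red {M : Type w₁} [AddCommGroup M] {N : Type w₂} [AddCommGroup N] (_c : Cochain M N) :
    Type w₁ where
  /-- the underlying element -/
  pt : M

namespace Red

variable {M : Type w₁} [AddCommGroup M] {N : Type w₂} [AddCommGroup N]

/-- The morphisms of the reduced category: automorphisms, labelled by the elements of `N`. -/
@[ext]
structure Hom {c : Cochain M N} (X Y : Red c) : Type w₂ where
  eq : X.pt = Y.pt
  /-- the label of the automorphism -/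
  val : N

variable {c : Cochain M N}

instance : Category (Red c) where
  Hom := Hom
  id _ := ⟨rfl, 0⟩
  comp f g := ⟨f.eq.trans g.eq, f.val + g.val⟩
  id_comp _ := Hom.ext (zero_add _)
  comp_id _ := Hom.ext (add_zero _)
  assoc _ _ _ := Hom.ext (add_assoc _ _ _)

@[ext]
theorem hom_ext {X Y : Red c} {f g : X ⟶ Y} (h : f.val = g.val) : f = g := Hom.ext h

@[simp]
theorem id_val (X : Red c) : (𝟙 X : X ⟶ X).val = 0 := rfl

@[simp]
theorem comp_val {X Y Z : Red c} (f : X ⟶ Y) (g : Y ⟶ Z) : (f ≫ g).val = f.val + g.val := rfl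

/-- The isomorphism with label `n`. -/
@[simps]
def isoMk {X Y : Red c} (h : X.pt = Y.pt) (n : N) : X ≅ Y where
  hom := ⟨h, n⟩
  inv := ⟨h.symm, -n⟩
  hom_inv_id := hom_ext (add_neg_cancel n)
  inv_hom_id := hom_ext (neg_add_cancel n)

theorem pt_eq_of_iso {X Y : Red c} (e : X ≅ Y) : X.pt = Y.pt := e.hom.eq

instance : IsGroupoid (Red c) where
  all_isIso f := (isoMk f.eq f.val).isIso_hom

/-- The data make sense for any cochain. This allows the cocycle relations to be deduced later from
coherence. -/
instance : MonoidalCategoryStruct (Red c) where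
  tensorObj X Y := ⟨X.pt + Y.pt⟩
  whiskerLeft X _ _ f := ⟨congrArg (X.pt + ·) f.eq, f.val⟩
  whiskerRight f Y := ⟨congrArg (· + Y.pt) f.eq, f.val⟩
  tensorHom f g := ⟨congrArg₂ (· + ·) f.eq g.eq, f.val + g.val⟩
  tensorUnit := ⟨0⟩
  associator X Y Z := isoMk (add_assoc _ _ _) (c.1 X.pt Y.pt Z.pt)
  leftUnitor _ := isoMk (zero_add _) 0
  rightUnitor _ := isoMk (add_zero _) 0

section

variable (X Y Z : Red c)

@[simp]
theorem tensor_pt : (X ⊗ Y).pt = X.pt + Y.pt := rfl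

@[simp]
theorem unit_pt : (𝟙_ (Red c)).pt = 0 := rfl

@[simp]
theorem whiskerLeft_val (f : Y ⟶ Z) : (X ◁ f).val = f.val := rfl

@[simp]
theorem whiskerRight_val (f : X ⟶ Y) : (f ▷ Z).val = f.val := rfl

@[simp]
theorem tensorHom_val {X' Y' : Red c} (f : X ⟶ Y) (g : X' ⟶ Y') :
    (f ⊗ₘ g).val = f.val + g.val := rfl

@[simp]
theorem associator_hom_val : (α_ X Y Z).hom.val = c.1 X.pt Y.pt Z.pt := rfl

@[simp]
theorem associator_inv_val : (α_ X Y Z).inv.val = -c.1 X.pt Y.pt Z.pt := rfl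

@[simp]
theorem leftUnitor_hom_val : (λ_ X).hom.val = 0 := rfl

@[simp]
theorem leftUnitor_inv_val : (λ_ X).inv.val = 0 := neg_zero

@[simp]
theorem rightUnitor_hom_val : (ρ_ X).hom.val = 0 := rfl

end

/-- The braiding of the reduced category. -/
abbrev braid (X Y : Red c) : X ⊗ Y ≅ Y ⊗ X := isoMk (add_comm _ _) (c.2 X.pt Y.pt)

section Cocycle

variable (c : Z3ab M N)

instance : MonoidalCategory (Red c.1) where
  tensorHom_def _ _ := rfl
  id_tensorHom_id _ _ := hom_ext (add_zero _)
  tensorHom_comp_tensorHom _ _ _ _ := hom_ext (by simp; abel)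
  whiskerLeft_id _ _ := rfl
  id_whiskerRight _ _ := rfl
  associator_naturality f g h := hom_ext (by simp [f.eq, g.eq, h.eq]; abel)
  leftUnitor_naturality _ := hom_ext (by simp)
  rightUnitor_naturality _ := hom_ext (by simp)
  pentagon X Y Z T := hom_ext (by
    have h := c.2.2.2.2.1 X.pt Y.pt Z.pt T.pt
    simp only [comp_val, whiskerLeft_val, whiskerRight_val, tensor_pt, associator_hom_val]
    rw [← sub_eq_zero, ← h]
    abel)
  triangle X Y := hom_ext (by simp [c.2.2.1])

instance : BraidedCategory (Red c.1) where
  braiding := braid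
  braiding_naturality_left f _ := hom_ext (by simp [f.eq, add_comm])
  braiding_naturality_right _ _ _ f := hom_ext (by simp [f.eq, add_comm])
  hexagon_forward X Y Z := hom_ext (by
    have h := c.2.2.2.2.2.1 X.pt Y.pt Z.pt
    simp only [comp_val, whiskerLeft_val, whiskerRight_val, tensor_pt, associator_hom_val,
      isoMk_hom_val]
    rw [← sub_eq_zero, ← h]
    abel)
  hexagon_reverse X Y Z := hom_ext (by
    have h := c.2.2.2.2.2.2 X.pt Y.pt Z.pt
    simp only [comp_val, whiskerLeft_val, whiskerRight_val, tensor_pt, associator_inv_val,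
      isoMk_hom_val]
    -- The reverse hexagon involves inverse associators, so it is the negative of the second hexagon
    -- relation.
    rw [← sub_eq_zero, ← neg_eq_zero, ← h]
    abel)

instance : GrCat.IsGrCategory (Red c.1) where
  exists_inverse X := ⟨⟨-X.pt⟩, ⟨isoMk (add_neg_cancel _) 0⟩, ⟨isoMk (neg_add_cancel _) 0⟩⟩

/-- The isomorphism `M ≅ π₀` of the reduced category. -/
def pi0Equiv : M ≃+ GrCat.Pi0 (Red c.1) where
  toFun m := GrCat.Pi0.cls ⟨m⟩
  invFun := Quotient.lift pt (fun _ _ ⟨e⟩ => pt_eq_of_iso e)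
  left_inv _ := rfl
  right_inv := by rintro ⟨X⟩; rfl
  map_add' _ _ := rfl

/-- The isomorphism `N ≅ π₁` of the reduced category. -/
def pi1Equiv : N ≃+ GrCat.Pi1 (Red c.1) where
  toFun n := (isoMk rfl n : 𝟙_ (Red c.1) ≅ 𝟙_ (Red c.1))
  invFun a := a.toIso.hom.val
  left_inv _ := rfl
  right_inv _ := Iso.ext rfl
  map_add' a b := Iso.ext (hom_ext (add_comm a b))

@[simp]
theorem toIso_pi1Equiv_val (n : N) : (pi1Equiv c n).toIso.hom.val = n := rfl

@[simp]
theorem gamma_val (X : Red c.1) (a : GrCat.Pi1 (Red c.1)) :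
    (GrCat.gamma X a).val = a.toIso.hom.val := by
  simp [GrCat.gamma]

@[simp]
theorem braiding_val (X Y : Red c.1) : (β_ X Y).hom.val = c.1.2 X.pt Y.pt := rfl

end Cocycle

end Red

/-- The reduced braided Gr-category of a cocycle, with its canonical pre-stick. -/
def preStickedRed {M : Type u} [AddCommGroup M] {N : Type v} [AddCommGroup N] (c : Z3ab M N) :
    GrCat.PreSticked M N where
  C := Red c.1
  p := Red.pi0Equiv c
  q := Red.pi1Equiv c

end AbCoh

/-! ### Functors between reduced categories give coboundaries -/

namespace GrCat

open AbCoh Functor.LaxMonoidal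

variable {M : Type u} [AddCommGroup M] {N : Type v} [AddCommGroup N]

/-- A braided functor between reduced categories exhibits their cocycles as cohomologous. -/
theorem mk_eq_of_functor {c c' : Z3ab M N} (F : Red c.1 ⥤ Red c'.1) [F.Braided]
    (h0 : ∀ m, mapPi0 F (Red.pi0Equiv c m) = Red.pi0Equiv c' m)
    (h1 : ∀ n, mapPi1 F (Red.pi1Equiv c n) = Red.pi1Equiv c' n) :
    H3ab.mk c = H3ab.mk c' := by
  have hF (X : Red c.1) : (F.obj X).pt = X.pt := congrArg (Red.pi0Equiv c').symm (h0 X.pt)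
  have hn {X Y : Red c.1} (f : X ⟶ Y) : (F.map f).val = f.val := by
    obtain ⟨x⟩ := X
    obtain ⟨y⟩ := Y
    obtain ⟨hxy, n⟩ := f
    obtain rfl : x = y := hxy
    have h2 : (Red.Hom.mk rfl n : (⟨x⟩ : Red c.1) ⟶ ⟨x⟩) = gamma ⟨x⟩ (Red.pi1Equiv c n) :=
      Red.hom_ext (by simp)
    rw [h2, map_gamma, h1]
    simp
  -- The constant `ε` makes `g` normalized, by the unit axioms, and cancels in the coboundary.
  let g (x y : M) : N := (μ F ⟨x⟩ ⟨y⟩).val + (ε F).val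
  refine QuotientAddGroup.eq.2 ⟨-g, (C2 M N).neg_mem ⟨fun x => ?_, fun y => ?_⟩, ?_⟩
  · have h := congrArg Red.Hom.val (right_unitality F ⟨x⟩)
    simp only [Red.comp_val, Red.whiskerLeft_val, hn, Red.rightUnitor_hom_val, add_zero] at h
    exact (add_comm _ _).trans h.symm
  · have h := congrArg Red.Hom.val (left_unitality F ⟨y⟩)
    simp only [Red.comp_val, Red.whiskerRight_val, hn, Red.leftUnitor_hom_val, add_zero] at h
    exact (add_comm _ _).trans h.symm
  · refine Prod.ext (funext fun x => funext fun y => funext fun z => ?_)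
      (funext fun x => funext fun y => ?_)
    · have h := congrArg Red.Hom.val (associativity F ⟨x⟩ ⟨y⟩ ⟨z⟩)
      simp only [Red.comp_val, Red.whiskerLeft_val, Red.whiskerRight_val, hn, hF,
        Red.associator_hom_val] at h
      change -(g y z) - -(g (x + y) z) + -(g x (y + z)) - -(g x y) =
        -c.1.1 x y z + c'.1.1 x y z
      rw [← sub_eq_zero] at h ⊢
      rw [← h]
      dsimp only [g]
      change _ = (μ F ⟨x⟩ ⟨y⟩).val + ((μ F ⟨x + y⟩ ⟨z⟩).val + c.1.1 x y z) -
        (c'.1.1 x y z + ((μ F ⟨y⟩ ⟨z⟩).val + (μ F ⟨x⟩ ⟨y + z⟩).val))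
      abel
    · have h := congrArg Red.Hom.val (Functor.LaxBraided.braided (F := F) ⟨x⟩ ⟨y⟩)
      simp only [Red.comp_val, Red.braiding_val, hn, hF] at h
      change -(g y x) - -(g x y) = -c.1.2 x y + c'.1.2 x y
      rw [← sub_eq_zero] at h ⊢
      rw [← h]
      dsimp only [g]
      abel

theorem mk_eq_of_rel {c c' : Z3ab M N} (h : (preStickedRed c).Rel (preStickedRed c')) :
    H3ab.mk c = H3ab.mk c' := by
  obtain ⟨F, hF, h0, h1⟩ := h
  exact @mk_eq_of_functor _ _ _ _ _ _ F hF h0 h1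

end GrCat

/-! ### Realizations of cochains -/

namespace GrCat

open AbCoh

/-- A realization of a cochain `(h, η)` in `C`: objects `X_x`, a homomorphism `N → π₁`, and
isomorphisms `X_x ⊗ X_y ≅ X_{x+y}` whose associativity and braiding defects are `h` and `η`. -/
structure Realization {M : Type w₁} [AddCommGroup M] {N : Type w₂} [AddCommGroup N]
    (c : Cochain M N) (C : Type u) [Category.{v} C] [MonoidalCategory C] [BraidedCategory C] where
  /-- the objects `X_x` -/
  obj : M → C
  /-- the homomorphism on coefficients -/
  coeff : N →+ Pi1 C
  /-- the unit isomorphism -/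
  unit : 𝟙_ C ≅ obj 0
  /-- the isomorphisms `X_x ⊗ X_y ≅ X_{x+y}` -/
  iso : ∀ x y z, x + y = z → (obj x ⊗ obj y ≅ obj z)
  iso_zero_left : ∀ x, (iso 0 x x (zero_add x)).hom = unit.inv ▷ obj x ≫ (λ_ (obj x)).hom
  iso_zero_right : ∀ x, (iso x 0 x (add_zero x)).hom = obj x ◁ unit.inv ≫ (ρ_ (obj x)).hom
  assoc : ∀ x y z,
    (iso x y (x + y) rfl).hom ▷ obj z ≫ (iso (x + y) z (x + y + z) rfl).hom ≫
        gamma (obj (x + y + z)) (coeff (c.1 x y z)) =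
      (α_ (obj x) (obj y) (obj z)).hom ≫ obj x ◁ (iso y z (y + z) rfl).hom ≫
        (iso x (y + z) (x + y + z) (add_assoc x y z).symm).hom
  braid : ∀ x y,
    (iso x y (x + y) rfl).hom ≫ gamma (obj (x + y)) (coeff (c.2 x y)) =
      (β_ (obj x) (obj y)).hom ≫ (iso y x (x + y) (add_comm y x)).hom

namespace Realization

variable {M : Type w₁} [AddCommGroup M] {N : Type w₂} [AddCommGroup N] {c : Cochain M N}
  {C : Type u} [Category.{v} C] [MonoidalCategory C] [BraidedCategory C] (R : Realization c C)

/-- The functor from the reduced category that a realization defines. -/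
@[simps]
def functor : Red c ⥤ C where
  obj X := R.obj X.pt
  map {_ Y} f := eqToHom (congrArg R.obj f.eq) ≫ gamma (R.obj Y.pt) (R.coeff f.val)
  map_id X := by simp
  map_comp := by
    rintro ⟨x⟩ ⟨y⟩ ⟨z⟩ ⟨hxy, m⟩ ⟨hyz, n⟩
    obtain rfl : x = y := hxy
    obtain rfl : x = z := hyz
    simp [gamma_add]

theorem iso_hom_eqToHom {x y z z' : M} (h : x + y = z) (h' : z = z') :
    (R.iso x y z h).hom ≫ eqToHom (congrArg R.obj h') = (R.iso x y z' (h.trans h')).hom := by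
  subst h'
  simp

theorem faithful_functor [IsGrCategory C] (hR : Function.Injective R.coeff) :
    R.functor.Faithful where
  map_injective {X Y} f g h := by
    simp only [functor_map] at h
    exact Red.hom_ext (hR (gamma_injective _ ((cancel_epi _).1 h)))

/-- The functor of a realization preserves the tensor product. -/
def inducingFunctorData : Monoidal.InducingFunctorData R.functor where
  μIso X Y := R.iso X.pt Y.pt (X.pt + Y.pt) rfl
  εIso := R.unit
  whiskerLeft_eq := by
    rintro ⟨x⟩ ⟨y⟩ ⟨z⟩ ⟨hyz, n⟩
    obtain rfl : y = z := hyz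
    change 𝟙 _ ≫ gamma (R.obj (x + y)) _ = (R.iso x y (x + y) rfl).inv ≫
      R.obj x ◁ (𝟙 _ ≫ gamma (R.obj y) _) ≫ (R.iso x y (x + y) rfl).hom
    simp [whiskerLeft_gamma, gamma_naturality]
  whiskerRight_eq := by
    rintro ⟨x⟩ ⟨y⟩ ⟨hxy, n⟩ ⟨z⟩
    obtain rfl : x = y := hxy
    change 𝟙 _ ≫ gamma (R.obj (x + z)) _ = (R.iso x z (x + z) rfl).inv ≫
      (𝟙 _ ≫ gamma (R.obj x) _) ▷ R.obj z ≫ (R.iso x z (x + z) rfl).hom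
    simp [gamma_whiskerRight, gamma_naturality]
  tensorHom_eq := by
    rintro ⟨x⟩ ⟨y⟩ ⟨z⟩ ⟨t⟩ ⟨hxy, m⟩ ⟨hzt, n⟩
    obtain rfl : x = y := hxy
    obtain rfl : z = t := hzt
    change 𝟙 _ ≫ gamma (R.obj (x + z)) (R.coeff (m + n)) = (R.iso x z (x + z) rfl).inv ≫
      ((𝟙 _ ≫ gamma (R.obj x) _) ⊗ₘ (𝟙 _ ≫ gamma (R.obj z) _)) ≫ (R.iso x z (x + z) rfl).hom
    rw [Category.id_comp, Category.id_comp, Category.id_comp, MonoidalCategory.tensorHom_def,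
      gamma_whiskerRight, whiskerLeft_gamma, ← gamma_add, ← map_add, gamma_naturality,
      Iso.inv_hom_id_assoc]
  associator_eq := by
    rintro ⟨x⟩ ⟨y⟩ ⟨z⟩
    have h := congrArg (· ≫ eqToHom (congrArg R.obj (add_assoc x y z))) (R.assoc x y z)
    simp only [Category.assoc, R.iso_hom_eqToHom _ (add_assoc x y z), gamma_naturality] at h
    change eqToHom _ ≫ gamma (R.obj (x + (y + z))) (R.coeff (c.1 x y z)) =
      ((R.iso (x + y) z (x + y + z) rfl).inv ≫ ((R.iso x y (x + y) rfl).inv ⊗ₘ 𝟙 (R.obj z))) ≫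
        (α_ (R.obj x) (R.obj y) (R.obj z)).hom ≫
        (𝟙 (R.obj x) ⊗ₘ (R.iso y z (y + z) rfl).hom) ≫
        (R.iso x (y + z) (x + (y + z)) rfl).hom
    rw [tensorHom_id, id_tensorHom, ← h]
    simp
  leftUnitor_eq := by
    rintro ⟨x⟩
    change eqToHom _ ≫ gamma (R.obj x) (R.coeff 0) =
      ((R.iso 0 x (0 + x) rfl).inv ≫ (R.unit.inv ⊗ₘ 𝟙 (R.obj x))) ≫ (λ_ (R.obj x)).hom
    rw [tensorHom_id, Category.assoc, ← R.iso_zero_left, Iso.eq_inv_comp, map_zero, gamma_zero,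
      Category.comp_id, R.iso_hom_eqToHom _ (zero_add x)]
  rightUnitor_eq := by
    rintro ⟨x⟩
    change eqToHom _ ≫ gamma (R.obj x) (R.coeff 0) =
      ((R.iso x 0 (x + 0) rfl).inv ≫ (𝟙 (R.obj x) ⊗ₘ R.unit.inv)) ≫ (ρ_ (R.obj x)).hom
    rw [id_tensorHom, Category.assoc, ← R.iso_zero_right, Iso.eq_inv_comp, map_zero, gamma_zero,
      Category.comp_id, R.iso_hom_eqToHom _ (add_zero x)]

theorem iso_hom_map_braid (X Y : Red c) :
    (R.inducingFunctorData.μIso X Y).hom ≫ R.functor.map (Red.braid X Y).hom =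
      (β_ (R.functor.obj X) (R.functor.obj Y)).hom ≫ (R.inducingFunctorData.μIso Y X).hom := by
  obtain ⟨x⟩ := X
  obtain ⟨y⟩ := Y
  change (R.iso x y (x + y) rfl).hom ≫ eqToHom _ ≫ gamma (R.obj (y + x)) (R.coeff (c.2 x y)) =
    (β_ (R.obj x) (R.obj y)).hom ≫ (R.iso y x (y + x) rfl).hom
  rw [← gamma_naturality, reassoc_of% R.braid x y,
    R.iso_hom_eqToHom _ (add_comm x y)]

/-- Through the faithful functor, the raw structure on `Red c` inherits all coherence axioms from
`C`. Their labels are the cocycle relations, with normalization coming from the unit axioms. -/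
theorem mem_Z3ab [IsGrCategory C] (hR : Function.Injective R.coeff) : c ∈ Z3ab M N := by
  have := R.faithful_functor hR
  let _mon : MonoidalCategory (Red c) := Monoidal.induced R.functor R.inducingFunctorData
  let _fun : R.functor.Monoidal := Monoidal.fromInducedMonoidal R.functor R.inducingFunctorData
  let _braid : BraidedCategory (Red c) := BraidedCategory.ofFaithful R.functor Red.braid
    R.iso_hom_map_braid
  refine ⟨fun y z => ?_, fun x z => ?_, fun x y => ?_, fun x y z t => ?_, fun x y z => ?_,
    fun x y z => ?_⟩
  · have h := congrArg Red.Hom.val (leftUnitor_tensor_hom (⟨y⟩ : Red c) ⟨z⟩)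
    change 0 = -c.1 0 y z + 0 at h
    simpa using h
  · have h := congrArg Red.Hom.val (MonoidalCategory.triangle (⟨x⟩ : Red c) ⟨z⟩)
    change c.1 x 0 z + 0 = 0 at h
    simpa using h
  · have h := congrArg Red.Hom.val (rightUnitor_tensor_hom (⟨x⟩ : Red c) ⟨y⟩)
    change 0 = c.1 x y 0 + 0 at h
    simpa using h.symm
  · have h := congrArg Red.Hom.val (MonoidalCategory.pentagon (⟨x⟩ : Red c) ⟨y⟩ ⟨z⟩ ⟨t⟩)
    simp only [Red.comp_val, Red.whiskerLeft_val, Red.whiskerRight_val, Red.tensor_pt,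
      Red.associator_hom_val] at h
    rw [← sub_eq_zero] at h
    rw [← h]
    abel
  · have h := congrArg Red.Hom.val
      (BraidedCategory.hexagon_forward (⟨x⟩ : Red c) ⟨y⟩ ⟨z⟩)
    change c.1 x y z + (c.2 x (y + z) + c.1 y z x) = c.2 x y + (c.1 y x z + c.2 x z) at h
    rw [← sub_eq_zero] at h
    rw [← h]
    abel
  · have h := congrArg Red.Hom.val
      (BraidedCategory.hexagon_reverse (⟨x⟩ : Red c) ⟨y⟩ ⟨z⟩)
    change -c.1 x y z + (c.2 (x + y) z + -c.1 z x y) =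
      c.2 y z + (-c.1 x z y + c.2 x z) at h
    rw [← sub_eq_zero, ← neg_eq_zero] at h
    rw [← h]
    abel

/-- The functor of a realization of a cocycle is braided. -/
theorem nonempty_braided [IsGrCategory C] {c : Z3ab M N} (R : Realization c.1 C)
    (hR : Function.Injective R.coeff) : Nonempty R.functor.Braided := by
  have := R.faithful_functor hR
  -- The induced monoidal structure has the same data as that of the cocycle, so the two coincide.
  let i : R.functor.Monoidal := Monoidal.fromInducedMonoidal R.functor R.inducingFunctorData
  exact ⟨{ i with braided := R.iso_hom_map_braid }⟩

end Realization

end GrCat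

/-! ### Sticks and their reductions -/

namespace GrCat

open AbCoh

section Sticks

variable {C : Type u} [Category.{v} C] [MonoidalCategory C] [BraidedCategory C] [IsGrCategory C]

variable (C) in
/-- Every braided Gr-category has a stick. -/
theorem nonempty_stick : Nonempty (Stick C) := by
  classical
  have hrep (s : Pi0 C) : ∃ X : C, Pi0.cls X = s ∧ (s = 0 → X = 𝟙_ C) := by
    by_cases hs : s = 0
    · exact ⟨𝟙_ C, hs.symm, fun _ => rfl⟩
    · obtain ⟨X, hX⟩ := Quotient.exists_rep s
      exact ⟨X, hX, fun h => absurd h hs⟩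
  choose rep cls_rep rep_zero using hrep
  have hiso (s t r : Pi0 C) (h : s + t = r) : Nonempty (rep s ⊗ rep t ≅ rep r) :=
    Quotient.exact (((congrArg₂ (· + ·) (cls_rep s) (cls_rep t)).trans h).trans (cls_rep r).symm)
  refine ⟨⟨rep, cls_rep, rep_zero 0 rfl, fun s t r h =>
    if hs : s = 0 then
      whiskerRightIso (eqToIso (rep_zero s hs)) (rep t) ≪≫ λ_ (rep t) ≪≫
        eqToIso (congrArg rep (by rw [← h, hs, zero_add]))
    else if ht : t = 0 then
      whiskerLeftIso (rep s) (eqToIso (rep_zero t ht)) ≪≫ ρ_ (rep s) ≪≫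
        eqToIso (congrArg rep (by rw [← h, ht, add_zero]))
    else (hiso s t r h).some, fun s => by simp, fun s => ?_⟩⟩
  -- At `s = t = 0` both normalizations apply; they agree because the two unitors of the unit object
  -- coincide.
  by_cases hs : s = 0
  · subst hs
    have key (X : C) (h : X = 𝟙_ C) :
        eqToHom h ▷ X ≫ (λ_ X).hom = X ◁ eqToHom h ≫ (ρ_ X).hom := by
      subst h
      simp [unitors_equal]
    simpa using key _ (rep_zero 0 rfl)
  · simp [hs]

namespace Stick

variable (σ : Stick C)

/-- Each constraint equation prescribes an automorphism of a single object, which is `γ` of some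
element. -/
theorem exists_isReduction : ∃ c, σ.IsReduction c := by
  have h1 (s t r : Pi0 C) := gamma_surjective (σ.rep (s + t + r))
    ((σ.iso (s + t) r (s + t + r) rfl).inv ≫ (σ.iso s t (s + t) rfl).inv ▷ σ.rep r ≫
      (α_ (σ.rep s) (σ.rep t) (σ.rep r)).hom ≫ σ.rep s ◁ (σ.iso t r (t + r) rfl).hom ≫
        (σ.iso s (t + r) (s + t + r) (add_assoc s t r).symm).hom)
  have h2 (s t : Pi0 C) := gamma_surjective (σ.rep (s + t))
    ((σ.iso s t (s + t) rfl).inv ≫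
      (β_ (σ.rep s) (σ.rep t)).hom ≫ (σ.iso t s (s + t) (add_comm t s)).hom)
  choose h hh using h1
  choose η hη using h2
  exact ⟨(h, η), fun s t r => by simp [hh], fun s t => by simp [hη]⟩

variable {σ}

theorem IsReduction.eq {c c' : Cochain (Pi0 C) (Pi1 C)} (h : σ.IsReduction c)
    (h' : σ.IsReduction c') : c = c' := by
  refine Prod.ext (funext fun s => funext fun t => funext fun r =>
    gamma_injective (σ.rep (s + t + r)) ?_)
    (funext fun s => funext fun t => gamma_injective (σ.rep (s + t)) ?_)
  · have := (h.1 s t r).trans (h'.1 s t r).symm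
    rwa [cancel_epi, cancel_epi] at this
  · have := (h.2 s t).trans (h'.2 s t).symm
    rwa [cancel_epi] at this

/-- The index `z` is kept variable because the realization below uses `p 0`, which is zero only
propositionally. -/
theorem iso_hom_of_left_eq_zero {z s : Pi0 C} (hz : z = 0) (h : z + s = s) :
    (σ.iso z s s h).hom =
      eqToHom ((congrArg σ.rep hz).trans σ.rep_zero) ▷ σ.rep s ≫ (λ_ (σ.rep s)).hom := by
  subst hz
  exact σ.iso_zero_left s

theorem iso_hom_of_right_eq_zero {z s : Pi0 C} (hz : z = 0) (h : s + z = s) :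
    (σ.iso s z s h).hom =
      σ.rep s ◁ eqToHom ((congrArg σ.rep hz).trans σ.rep_zero) ≫ (ρ_ (σ.rep s)).hom := by
  subst hz
  exact σ.iso_zero_right s

theorem IsReduction.assoc {c : Cochain (Pi0 C) (Pi1 C)} (hc : σ.IsReduction c)
    {s t r st tr str : Pi0 C} (h1 : s + t = st) (h2 : st + r = str) (h3 : t + r = tr)
    (h4 : s + tr = str) :
    (σ.iso s t st h1).hom ▷ σ.rep r ≫ (σ.iso st r str h2).hom ≫ gamma (σ.rep str) (c.1 s t r) =
      (α_ (σ.rep s) (σ.rep t) (σ.rep r)).hom ≫ σ.rep s ◁ (σ.iso t r tr h3).hom ≫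
        (σ.iso s tr str h4).hom := by
  subst h1 h3 h2
  exact hc.1 s t r

theorem IsReduction.braid {c : Cochain (Pi0 C) (Pi1 C)} (hc : σ.IsReduction c)
    {s t st : Pi0 C} (h1 : s + t = st) (h2 : t + s = st) :
    (σ.iso s t st h1).hom ≫ gamma (σ.rep st) (c.2 s t) =
      (β_ (σ.rep s) (σ.rep t)).hom ≫ (σ.iso t s st h2).hom := by
  subst h1
  exact hc.2 s t

variable {M : Type w₁} [AddCommGroup M] {N : Type w₂} [AddCommGroup N]

/-- The realization that a stick defines of its reduction, transported along isomorphisms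
`M ≅ π₀` and `N ≅ π₁`. -/
def IsReduction.realization {c : Cochain (Pi0 C) (Pi1 C)} (hc : σ.IsReduction c)
    (p : M ≃+ Pi0 C) (q : N ≃+ Pi1 C) :
    Realization (fun x y z => q.symm (c.1 (p x) (p y) (p z)),
      fun x y => q.symm (c.2 (p x) (p y))) C where
  obj x := σ.rep (p x)
  coeff := q
  unit := eqToIso (σ.rep_zero.symm.trans (congrArg σ.rep (map_zero p).symm))
  iso x y z h := σ.iso (p x) (p y) (p z) (by rw [← h, map_add])
  iso_zero_left x := iso_hom_of_left_eq_zero (map_zero p) _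
  iso_zero_right x := iso_hom_of_right_eq_zero (map_zero p) _
  assoc x y z := by
    simpa using hc.assoc _ _ _ _
  braid x y := by
    simpa using hc.braid _ _

theorem IsReduction.mem_Z3ab {c : Cochain (Pi0 C) (Pi1 C)} (hc : σ.IsReduction c) :
    c ∈ Z3ab (Pi0 C) (Pi1 C) :=
  (hc.realization (AddEquiv.refl _) (AddEquiv.refl _)).mem_Z3ab (AddEquiv.refl _).injective

end Stick

end Sticks

/-! ### Comparison with reduced categories and the classification -/

variable {M : Type u} [AddCommGroup M] {N : Type v} [AddCommGroup N]

theorem Realization.rel {c : Z3ab M N} {B : PreSticked M N} (R : Realization c.1 B.C)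
    (h0 : ∀ m, Pi0.cls (R.obj m) = B.p m) (h1 : ∀ n, R.coeff n = B.q n) :
    (preStickedRed c).Rel B := by
  obtain ⟨hR⟩ := R.nonempty_braided fun m n h => B.q.injective (by rw [← h1, ← h1, h])
  refine ⟨R.functor, hR, h0, fun n => ?_⟩
  refine mapPi1_eq_of_map_gamma (C := Red c.1) R.functor ⟨0⟩ ?_
  rw [← h1]
  exact (Category.id_comp _).trans (congrArg (fun n => gamma (R.obj 0) (R.coeff n))
    ((Red.gamma_val c _ _).trans (Red.toIso_pi1Equiv_val c n)))

/-- A pre-sticked braided Gr-category is equivalent to the reduced category of the cocycle of any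
of its sticks. -/
theorem rel_of_isReduction {B : PreSticked M N} {σ : Stick B.C} {c : Z3ab (Pi0 B.C) (Pi1 B.C)}
    (hc : σ.IsReduction c.1) :
    (preStickedRed (Z3ab.push B.q.symm.toAddMonoidHom (Z3ab.pull B.p.toAddMonoidHom c))).Rel B :=
  Realization.rel (hc.realization B.p B.q) (fun _ => σ.cls_rep _) fun _ => rfl

theorem rel_of_mk_eq {c c' : Z3ab M N} (h : H3ab.mk c = H3ab.mk c') :
    (preStickedRed c).Rel (preStickedRed c') := by
  -- Symmetry fixes the sign: `∂_ab(g) = c - c'`, so `g` itself labels the isomorphisms of the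
  -- realization.
  obtain ⟨g, ⟨g1, g2⟩, hg⟩ := QuotientAddGroup.eq.1 h.symm
  have hg1 (x y z : M) : g y z - g (x + y) z + g x (y + z) - g x y = -c'.1.1 x y z + c.1.1 x y z :=
    congrFun₃ (congrArg Prod.fst hg) x y z
  have hg2 (x y : M) : g y x - g x y = -c'.1.2 x y + c.1.2 x y :=
    congrFun₂ (congrArg Prod.snd hg) x y
  let R : Realization c.1 (Red c'.1) :=
    { obj := Red.mk
      coeff := Red.pi1Equiv c'
      unit := Iso.refl _
      iso := fun x y z h => Red.isoMk h (g x y)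
      iso_zero_left := fun x => Red.hom_ext (by simp [g2])
      iso_zero_right := fun x => Red.hom_ext (by simp [g1])
      assoc := fun x y z => Red.hom_ext (by
        have h := hg1 x y z
        rw [← sub_eq_zero, ← neg_eq_zero] at h
        simp only [AddMonoidHom.coe_coe, Red.comp_val, Red.whiskerRight_val, Red.isoMk_hom_val,
          Red.gamma_val, Red.toIso_pi1Equiv_val, Red.associator_hom_val, Red.whiskerLeft_val]
        rw [← sub_eq_zero, ← h]
        abel)
      braid := fun x y => Red.hom_ext (by
        have h := hg2 x y
        rw [← sub_eq_zero, ← neg_eq_zero] at h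
        simp only [AddMonoidHom.coe_coe, Red.comp_val, Red.isoMk_hom_val, Red.gamma_val,
          Red.toIso_pi1Equiv_val, Red.braiding_val]
        rw [← sub_eq_zero, ← h]
        abel) }
  exact R.rel (fun _ => rfl) fun _ => rfl

end GrCat

/-- Classification of braided Gr-categories with a pre-stick of type `(M, N)` by `H³_ab(M, N)`. -/
theorem theorem4p4 (M : Type u) [AddCommGroup M] (N : Type v) [AddCommGroup N] :
    (∀ (C : Type u) [Category.{v} C] [MonoidalCategory C] [BraidedCategory C]
      [GrCat.IsGrCategory C],
      Nonempty (GrCat.Stick C) ∧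
      ∀ σ : GrCat.Stick C, ∃ c ∈ AbCoh.Z3ab (GrCat.Pi0 C) (GrCat.Pi1 C),
        ∀ c' : AbCoh.Cochain (GrCat.Pi0 C) (GrCat.Pi1 C), σ.IsReduction c' ↔ c' = c) ∧
    Equivalence (GrCat.PreSticked.Rel (M := M) (N := N)) ∧
    ∃ Γ : Quot (GrCat.PreSticked.Rel (M := M) (N := N)) → AbCoh.H3ab M N,
      Function.Bijective Γ ∧
      ∀ (B : GrCat.PreSticked M N) (σ : GrCat.Stick B.C)
        (c : AbCoh.Z3ab (GrCat.Pi0 B.C) (GrCat.Pi1 B.C)), σ.IsReduction c.1 →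
        Γ (Quot.mk _ B) =
          AbCoh.H3ab.push B.q.symm.toAddMonoidHom
            (AbCoh.H3ab.pull B.p.toAddMonoidHom (AbCoh.H3ab.mk c)) := by
  refine ⟨fun C _ _ _ _ => ⟨GrCat.nonempty_stick C, fun σ => ?_⟩,
    GrCat.PreSticked.equivalence_rel, ?_⟩
  · obtain ⟨c, hc⟩ := σ.exists_isReduction
    exact ⟨c, hc.mem_Z3ab, fun c' => ⟨fun h => h.eq hc, fun h => h ▸ hc⟩⟩
  have hex (B : GrCat.PreSticked M N) : ∃ c : AbCoh.Z3ab M N, (AbCoh.preStickedRed c).Rel B := by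
    obtain ⟨σ⟩ := GrCat.nonempty_stick B.C
    obtain ⟨c, hc⟩ := σ.exists_isReduction
    exact ⟨_, GrCat.rel_of_isReduction (c := ⟨c, hc.mem_Z3ab⟩) hc⟩
  choose c hc using hex
  -- All cocycles whose reduced category is related to `B` share one class. This gives independence
  -- of the choice, the formula for any stick, and surjectivity.
  have hmk {d : AbCoh.Z3ab M N} {B : GrCat.PreSticked M N} (h : (AbCoh.preStickedRed d).Rel B) :
      AbCoh.H3ab.mk (c B) = AbCoh.H3ab.mk d :=
    GrCat.mk_eq_of_rel ((hc B).trans h.symm)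
  refine ⟨Quot.lift (fun B => AbCoh.H3ab.mk (c B)) fun A B h => hmk ((hc B).trans h.symm),
    ⟨?_, ?_⟩, fun B σ c hσ => hmk (GrCat.rel_of_isReduction hσ)⟩
  · rintro ⟨A⟩ ⟨B⟩ h
    exact Quot.sound ((hc A).symm.trans ((GrCat.rel_of_mk_eq h).trans (hc B)))
  · intro x
    obtain ⟨d, rfl⟩ := QuotientAddGroup.mk_surjective x
    exact ⟨Quot.mk _ (AbCoh.preStickedRed d), hmk (GrCat.PreSticked.Rel.refl _)⟩
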